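/- An \emph{injection structure} $(A,f)$ is a non-empty set $A$ with a one-to-one function $f:A\to A$; it is \emph{computable} if $A\subseteq\omega$ is a computable set and $f$ is computable. The orbit of $a$ is $\{b\in A: \exists n\in\omega\,(f^n(a)=b \text{ or } f^n(b)=a)\}$. The character $\chi(A,f)$ is the set of pairs $\langle k,n\rangle$ of positive integers such that there are at least $n$ orbits of size $k$; it is bounded if the sizes $k$ occurring in it are bounded. A $Z$-orbit (an $\omega$-orbit) is an orbit isomorphic to $\mathbb Z$ (to $\omega$) with the successor function. An infinite set $C\subseteq\omega$ is cohesive if for every c.e. set $W$, $W\cap C$ or $\overline W\cap C$ is finite; $X\subseteq^*Y$ means that $X\setminus Y$ is finite. The cohesive power $\Pi_C\mathcal A$ of a computable injection structure $\mathcal A=(A,f)$ over $C$ consists of the partial computable functions $\psi:\omega\to A$ with $C\subseteq^*\mathrm{dom}(\psi)$, modulo the relation $C\subseteq^*\{i:\psi_1(i){\downarrow}=\psi_2(i){\downarrow}\}$, with the function $[\psi]\mapsto[f\circ\psi]$; it is again an injection structure. \textbf{Theorem.} Let $\mathcal A$ be a computable injection structure and let $C$ be a cohesive set. Then: (1) $\chi(\Pi_C\mathcal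 A)=\chi(\mathcal A)$; (2) $\Pi_C\mathcal A$ and $\mathcal A$ have the same number of $\omega$-orbits; (3) if $\mathcal A$ has unbounded character or has an infinite orbit, then $\Pi_C\mathcal A$ has infinitely many $Z$-orbits; (4) $\Pi_C\mathcal A\cong\mathcal A$ if and only if either $\mathcal A$ has bounded character and no infinite orbits, or $\mathcal A$ has infinitely many $Z$-orbits. -/

import Mathlib

/-- An infinite set `C` of natural numbers is cohesive if every c.e. set `W` meets `C`
in a finite or a cofinite (relative to `C`) set. -/
def IsCohesive (C : Set ℕ) : Prop :=
  C.Infinite ∧ ∀ W : Set ℕ, REPred (fun n => n ∈ W) → (W ∩ C).Finite ∨ (Wᶜ ∩ C).Finite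

/-- Inclusion up to finitely many elements. -/
def AlmostSubset (C S : Set ℕ) : Prop := (C \ S).Finite

/-- A non-empty set with a one-to-one function from it to itself. -/
structure InjectionStructure where
  Carrier : Type
  nonempty : Nonempty Carrier
  f : Carrier → Carrier
  injective : Function.Injective f

namespace InjectionStructure

/-- The orbit of `a`. -/
def orbit (S : InjectionStructure) (a : S.Carrier) : Set S.Carrier :=
  {b | ∃ n : ℕ, S.f^[n] a = b ∨ S.f^[n] b = a}

/-- The set of all orbits. -/
def orbits (S : InjectionStructure) : Set (Set S.Carrier) := Set.range S.orbit

/-- The pairs `(k, n)` of positive integers such that there are at least `n` orbits of size `k`. -/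
def character (S : InjectionStructure) : Set (ℕ × ℕ) :=
  {p | 0 < p.1 ∧ 0 < p.2 ∧ (p.2 : ℕ∞) ≤ {O ∈ S.orbits | O.encard = (p.1 : ℕ∞)}.encard}

/-- There is a finite bound on the sizes `k` that occur in the character. -/
def HasBoundedCharacter (S : InjectionStructure) : Prop :=
  ∃ K : ℕ, ∀ p ∈ S.character, p.1 ≤ K

/-- Some orbit is infinite. -/
def HasInfiniteOrbit (S : InjectionStructure) : Prop := ∃ O ∈ S.orbits, O.Infinite

/-- The `ω`-orbits: those isomorphic to `ω` with the successor function. -/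
def omegaOrbits (S : InjectionStructure) : Set (Set S.Carrier) :=
  {O ∈ S.orbits | ∃ e : ℕ ≃ O, ∀ n : ℕ, (e (n + 1) : S.Carrier) = S.f (e n)}

/-- The `Z`-orbits: those isomorphic to the integers with the successor function. -/
def zOrbits (S : InjectionStructure) : Set (Set S.Carrier) :=
  {O ∈ S.orbits | ∃ e : ℤ ≃ O, ∀ z : ℤ, (e (z + 1) : S.Carrier) = S.f (e z)}

/-- There is a bijection that commutes with the functions. -/
def IsIsomorphic (S T : InjectionStructure) : Prop :=
  ∃ e : S.Carrier ≃ T.Carrier, ∀ a, e (S.f a) = T.f (e a)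

end InjectionStructure

/-- An injection structure on a computable set of natural numbers whose function is computable.
Since the domain is computable, computability of the function on the domain is the same as being
the restriction of a computable function on all natural numbers. -/
structure ComputableInjectionStructure where
  domain : Set ℕ
  domain_nonempty : domain.Nonempty
  domain_computable : ComputablePred (fun n => n ∈ domain)
  f : domain → domain
  injective : Function.Injective f
  f_computable : ∃ g : ℕ → ℕ, Computable g ∧ ∀ a : domain, g a = f a

namespace ComputableInjectionStructure

/-- The underlying injection structure. -/
def toInjectionStructure (A : ComputableInjectionStructure) : InjectionStructure where
  Carrier := A.domain
  nonempty := A.domain_nonempty.to_subtype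
  f := A.f
  injective := A.injective

/-- The partial computable functions from the natural numbers to the domain of `A` that are defined
on almost all of `C`. -/
def PowerRep (A : ComputableInjectionStructure) (C : Set ℕ) : Type :=
  {ψ : ℕ →. A.domain //
    Partrec (fun i => (ψ i).map (fun a : A.domain => (a : ℕ))) ∧ AlmostSubset C ψ.Dom}

/-- Two representatives are identified if on almost all of `C` both are defined and equal. -/
def powerSetoid (A : ComputableInjectionStructure) (C : Set ℕ) : Setoid (A.PowerRep C) where
  r ψ φ := AlmostSubset C {i | ∃ a, a ∈ ψ.1 i ∧ a ∈ φ.1 i}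
  iseqv :=
    { refl := fun ψ => ψ.2.2.subset (by
        rintro i ⟨hi, h⟩
        refine ⟨hi, fun hd => h ?_⟩
        obtain ⟨a, ha⟩ := Part.dom_iff_mem.1 hd
        exact ⟨a, ha, ha⟩)
      symm := fun {ψ φ} h => h.subset (by
        rintro i ⟨hi, h⟩
        exact ⟨hi, fun ⟨a, ha, hb⟩ => h ⟨a, hb, ha⟩⟩)
      trans := fun {ψ φ χ} h₁ h₂ => (Set.Finite.union h₁ h₂).subset (by
        rintro i ⟨hi, h⟩
        by_cases h₁ : ∃ a, a ∈ ψ.1 i ∧ a ∈ φ.1 i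
        · right
          refine ⟨hi, ?_⟩
          rintro ⟨b, hb, hc⟩
          obtain ⟨a, ha, hab⟩ := h₁
          exact h ⟨a, ha, Part.mem_unique hab hb ▸ hc⟩
        · exact Or.inl ⟨hi, h₁⟩) }

/-- Composition of a representative with the function of `A`. -/
def repMap (A : ComputableInjectionStructure) (C : Set ℕ) (ψ : A.PowerRep C) : A.PowerRep C :=
  ⟨fun i => (ψ.1 i).map A.f, by
    obtain ⟨g, hg, hgf⟩ := A.f_computable
    have h := ψ.2.1.map (hg.comp Computable.snd).to₂
    refine h.of_eq fun i => ?_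
    ext n
    simp only [Part.mem_map_iff, exists_exists_and_eq_and, hgf], ψ.2.2⟩

/-- The cohesive power of `A` over `C`. -/
def cohesivePower (A : ComputableInjectionStructure) (C : Set ℕ) : InjectionStructure where
  Carrier := Quotient (A.powerSetoid C)
  nonempty := by
    obtain ⟨a, ha⟩ := A.domain_nonempty
    refine ⟨Quotient.mk _ ⟨fun _ => Part.some ⟨a, ha⟩, ?_, ?_⟩⟩
    · refine (Computable.const (α := ℕ) a).partrec.of_eq fun i => ?_
      exact (Part.map_some (fun x : A.domain => (x : ℕ)) ⟨a, ha⟩).symm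
    · refine Set.finite_empty.subset ?_
      rintro i ⟨_, h⟩
      exact h trivial
  f := Quotient.map (A.repMap C) (by
    intro ψ φ h
    refine Set.Finite.subset h ?_
    rintro i ⟨hi, h⟩
    exact ⟨hi, fun ⟨a, ha, hb⟩ => h ⟨A.f a, Part.mem_map _ ha, Part.mem_map _ hb⟩⟩)
  injective := by
    intro x y
    induction x using Quotient.inductionOn
    induction y using Quotient.inductionOn
    intro h
    refine Quotient.sound (Set.Finite.subset (Quotient.exact h) ?_)
    rintro i ⟨hi, h⟩
    refine ⟨hi, ?_⟩
    rintro ⟨c, hc, hd⟩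
    obtain ⟨a, ha, rfl⟩ := (Part.mem_map_iff _).1 hc
    obtain ⟨b, hb, hab⟩ := (Part.mem_map_iff _).1 hd
    exact h ⟨a, ha, A.injective hab ▸ hb⟩

end ComputableInjectionStructure

/-!
The orbits of an injection structure are finite cycles, `ω`-orbits and `Z`-orbits, and two injection
structures are isomorphic as soon as they have the same number of orbits of each kind
(`InjectionStructure.isIsomorphic_of_mk_eq`). The isomorphism is obtained by choosing a base point
in every orbit, the initial point if there is one, and matching points in the same position relative
to matching base points (`InjectionStructure.isIsomorphic_of_base`).

The sets that contain almost all of a cohesive set `C` form a filter which decides every c.e. set.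
Hence a c.e. property holds at almost all values of a representative or fails at almost all of them
(`ComputableInjectionStructure.eventually_or`). Consequently a representative whose values almost
all lie in a finite set represents a constant (`exists_eq_diag`). Having a given period and having a
preimage pass between a point of the cohesive power and almost all values of a representative
(`eventually_minimalPeriod_eq`, `toPower_mem_range_iff`, `eventually_notMem_range`). So if `A` has
finitely many orbits of size `k`, or finitely many points outside the range of its function, then
the corresponding points of the cohesive power are exactly the constants; if `A` has infinitely
many, then so has the cohesive power, which is countable. This yields the character and the number
of `ω`-orbits, as the latter correspond to the points outside the range.

The character of `A` is bounded and `A` has no infinite orbits exactly when some positive iterate of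
the function is the identity (`InjectionStructure.exists_iterate_eq_self_iff`), a property that the
cohesive power inherits; then neither structure has `Z`-orbits. Otherwise there are computable
points `b i` with more than `i * i` distinct iterates (`exists_computable_period`), and the
functions `i ↦ f^[(m + 1) * i] (b i)` represent points in infinitely many different `Z`-orbits
(`zOrbits_cohesivePower_infinite`). Together with the classification this decides when the cohesive
power is isomorphic to `A`.
-/

namespace InjectionStructure

open Function

/-! ### Orbits of an injection structure -/

section Orbits

variable {S T : InjectionStructure}

theorem iterate_injective (S : InjectionStructure) (n : ℕ) : Injective S.f^[n] :=
  S.injective.iterate n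

theorem mem_orbit_iff {a b : S.Carrier} :
    b ∈ S.orbit a ↔ ∃ m n : ℕ, S.f^[m] a = S.f^[n] b := by
  constructor
  · rintro ⟨n, h | h⟩
    · exact ⟨n, 0, h⟩
    · exact ⟨0, n, h.symm⟩
  · rintro ⟨m, n, h⟩
    rcases le_total n m with hnm | hnm
    · obtain ⟨d, rfl⟩ := Nat.exists_eq_add_of_le hnm
      rw [iterate_add_apply] at h
      exact ⟨d, Or.inl (S.iterate_injective n h)⟩
    · obtain ⟨d, rfl⟩ := Nat.exists_eq_add_of_le hnm
      rw [iterate_add_apply] at h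
      exact ⟨d, Or.inr (S.iterate_injective m h).symm⟩

theorem mem_orbit_self (a : S.Carrier) : a ∈ S.orbit a := ⟨0, Or.inl rfl⟩

theorem iterate_mem_orbit (a : S.Carrier) (n : ℕ) : S.f^[n] a ∈ S.orbit a := ⟨n, Or.inl rfl⟩

theorem apply_mem_orbit_iff {a b : S.Carrier} : S.f b ∈ S.orbit a ↔ b ∈ S.orbit a := by
  rw [mem_orbit_iff, mem_orbit_iff]
  constructor
  · rintro ⟨m, n, h⟩
    exact ⟨m, n + 1, by rw [h, iterate_succ_apply]⟩
  · rintro ⟨m, n, h⟩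
    exact ⟨m + 1, n, by rw [iterate_succ_apply', h, ← iterate_succ_apply, iterate_succ_apply']⟩

theorem orbit_eq_of_mem {a b : S.Carrier} (h : b ∈ S.orbit a) : S.orbit b = S.orbit a := by
  obtain ⟨m, n, h⟩ := mem_orbit_iff.1 h
  ext c
  rw [mem_orbit_iff, mem_orbit_iff]
  constructor
  · rintro ⟨p, q, h'⟩
    refine ⟨p + m, n + q, ?_⟩
    rw [iterate_add_apply, h, iterate_add_apply, ← h', ← iterate_add_apply, ← iterate_add_apply,
      add_comm]
  · rintro ⟨p, q, h'⟩
    refine ⟨p + n, m + q, ?_⟩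
    rw [iterate_add_apply, ← h, iterate_add_apply, ← h', ← iterate_add_apply, ← iterate_add_apply,
      add_comm]

theorem orbit_eq_orbit_iff {a b : S.Carrier} : S.orbit a = S.orbit b ↔ a ∈ S.orbit b :=
  ⟨fun h => h ▸ mem_orbit_self a, orbit_eq_of_mem⟩

theorem eq_orbit_of_mem {O : Set S.Carrier} (hO : O ∈ S.orbits) {a : S.Carrier} (ha : a ∈ O) :
    O = S.orbit a := by
  obtain ⟨b, rfl⟩ := hO
  exact (orbit_eq_of_mem ha).symm

theorem nonempty_of_mem_orbits {O : Set S.Carrier} (hO : O ∈ S.orbits) : O.Nonempty := by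
  obtain ⟨b, rfl⟩ := hO
  exact ⟨b, mem_orbit_self b⟩

theorem mem_range_of_minimalPeriod_pos {a : S.Carrier} (h : 0 < minimalPeriod S.f a) :
    a ∈ Set.range S.f :=
  periodicPts_subset_range (minimalPeriod_pos_iff_mem_periodicPts.1 h)

theorem iterate_eq_iterate_iff {a : S.Carrier} {m n : ℕ} :
    S.f^[m] a = S.f^[n] a ↔ m ≡ n [MOD minimalPeriod S.f a] := by
  wlog hmn : m ≤ n generalizing m n
  · rw [eq_comm, this (le_of_not_ge hmn)]
    exact ⟨Nat.ModEq.symm, Nat.ModEq.symm⟩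
  obtain ⟨d, rfl⟩ := Nat.exists_eq_add_of_le hmn
  rw [iterate_add_apply, (S.iterate_injective m).eq_iff, eq_comm, Nat.modEq_iff_dvd' hmn,
    Nat.add_sub_cancel_left]
  exact isPeriodicPt_iff_minimalPeriod_dvd

theorem iterate_injective_of_minimalPeriod_eq_zero {a : S.Carrier}
    (h : minimalPeriod S.f a = 0) : Injective fun n : ℕ => S.f^[n] a := by
  intro m n hmn
  have := iterate_eq_iterate_iff.1 hmn
  rwa [h, Nat.modEq_zero_iff] at this

theorem orbit_eq_range_of_minimalPeriod_pos {a : S.Carrier} (h : 0 < minimalPeriod S.f a) :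
    S.orbit a = Set.range fun n : ℕ => S.f^[n] a := by
  ext b
  constructor
  · rintro ⟨n, hn | hn⟩
    · exact ⟨n, hn⟩
    · have hle : n ≤ n * minimalPeriod S.f a := Nat.le_mul_of_pos_right n h
      obtain ⟨d, hd⟩ := Nat.exists_eq_add_of_le hle
      refine ⟨d, S.iterate_injective n ?_⟩
      simp only
      rw [hn, ← iterate_add_apply, ← hd]
      exact (isPeriodicPt_minimalPeriod S.f a).const_mul n
  · rintro ⟨n, rfl⟩
    exact iterate_mem_orbit a n

theorem encard_orbit (a : S.Carrier) :
    (S.orbit a).encard = if minimalPeriod S.f a = 0 then ⊤ else (minimalPeriod S.f a : ℕ∞) := by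
  split_ifs with h
  · rw [Set.encard_eq_top_iff]
    exact (Set.infinite_range_of_injective
      (iterate_injective_of_minimalPeriod_eq_zero h)).mono
      (by rintro _ ⟨n, rfl⟩; exact iterate_mem_orbit a n)
  · have hpos := Nat.pos_of_ne_zero h
    have : S.orbit a = (fun n : ℕ => S.f^[n] a) '' Set.Iio (minimalPeriod S.f a) := by
      rw [orbit_eq_range_of_minimalPeriod_pos hpos]
      ext b
      constructor
      · rintro ⟨n, rfl⟩
        exact ⟨n % minimalPeriod S.f a, Nat.mod_lt _ hpos, iterate_mod_minimalPeriod_eq⟩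
      · rintro ⟨n, -, rfl⟩
        exact ⟨n, rfl⟩
    rw [this, iterate_injOn_Iio_minimalPeriod.encard_image, Set.encard_eq_coe_toFinset_card]
    simp

theorem encard_orbit_eq_natCast_iff {a : S.Carrier} {k : ℕ} (hk : 0 < k) :
    (S.orbit a).encard = (k : ℕ∞) ↔ minimalPeriod S.f a = k := by
  rw [encard_orbit]
  split_ifs with h
  · simp [h, hk.ne]
  · exact Nat.cast_inj

theorem encard_orbit_eq_top_iff {a : S.Carrier} :
    (S.orbit a).encard = ⊤ ↔ minimalPeriod S.f a = 0 := by
  rw [encard_orbit]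
  split_ifs with h <;> simp [h]

theorem minimalPeriod_eq_of_encard_orbit_eq {a : S.Carrier} {b : T.Carrier}
    (h : (S.orbit a).encard = (T.orbit b).encard) :
    minimalPeriod S.f a = minimalPeriod T.f b := by
  rcases Nat.eq_zero_or_pos (minimalPeriod T.f b) with hb | hb
  · rw [hb, ← encard_orbit_eq_top_iff, h, encard_orbit_eq_top_iff.2 hb]
  · rw [← encard_orbit_eq_natCast_iff hb, h, encard_orbit_eq_natCast_iff hb]

/-- Two points outside the range of the function lie in different orbits. -/
theorem eq_of_mem_orbit_of_notMem_range {a b : S.Carrier} (ha : a ∉ Set.range S.f)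
    (hb : b ∉ Set.range S.f) (h : b ∈ S.orbit a) : b = a := by
  obtain ⟨n | n, h | h⟩ := h
  · exact h.symm
  · exact h
  · exact absurd ⟨_, (iterate_succ_apply' S.f n a).symm.trans h⟩ hb
  · exact absurd ⟨_, (iterate_succ_apply' S.f n b).symm.trans h⟩ ha

theorem omegaOrbits_eq (S : InjectionStructure) :
    S.omegaOrbits = {O ∈ S.orbits | ∃ a ∈ O, a ∉ Set.range S.f} := by
  ext O
  refine and_congr_right fun hO => ?_
  constructor
  · rintro ⟨e, he⟩
    refine ⟨e 0, (e 0).2, ?_⟩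
    rintro ⟨b, hb⟩
    have hbO : b ∈ O := by
      have h0 := (e 0).2
      rw [eq_orbit_of_mem hO h0, ← apply_mem_orbit_iff, hb]
      exact mem_orbit_self _
    obtain ⟨n, hn⟩ := e.surjective ⟨b, hbO⟩
    have h1 : e (n + 1) = e 0 := Subtype.ext (by rw [he, hn]; exact hb)
    exact Nat.succ_ne_zero n (e.injective h1)
  · rintro ⟨a, ha, har⟩
    have hp : minimalPeriod S.f a = 0 := by
      by_contra h
      exact har (mem_range_of_minimalPeriod_pos (Nat.pos_of_ne_zero h))
    rw [eq_orbit_of_mem hO ha]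
    refine ⟨Equiv.ofBijective (fun n => ⟨S.f^[n] a, iterate_mem_orbit a n⟩) ⟨?_, ?_⟩, ?_⟩
    · intro m n h
      exact iterate_injective_of_minimalPeriod_eq_zero hp (congrArg Subtype.val h)
    · rintro ⟨b, n | n, h | h⟩
      · exact ⟨0, Subtype.ext h⟩
      · exact ⟨0, Subtype.ext h.symm⟩
      · exact ⟨n + 1, Subtype.ext h⟩
      · exact absurd ⟨_, (iterate_succ_apply' S.f n b).symm.trans h⟩ har
    · intro n
      exact iterate_succ_apply' S.f n a

theorem zOrbits_eq (S : InjectionStructure) :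
    S.zOrbits = {O ∈ S.orbits | O.encard = ⊤ ∧ ∀ a ∈ O, a ∈ Set.range S.f} := by
  ext O
  refine and_congr_right fun hO => ?_
  constructor
  · rintro ⟨e, he⟩
    refine ⟨?_, fun a ha => ?_⟩
    · rw [Set.encard_eq_top_iff]
      exact Set.infinite_coe_iff.1 (Infinite.of_injective e e.injective)
    · obtain ⟨z, hz⟩ := e.surjective ⟨a, ha⟩
      refine ⟨e (z - 1), ?_⟩
      rw [← he, sub_add_cancel, hz]
  · rintro ⟨hinf, hr⟩
    obtain ⟨a, rfl⟩ := hO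
    -- The function restricts to a permutation `σ` of the orbit, and `z ↦ σ ^ z a` is a bijection.
    let σ : Equiv.Perm (S.orbit a) :=
      Equiv.ofBijective (fun b => ⟨S.f b, apply_mem_orbit_iff.2 b.2⟩) ⟨fun b c h =>
        Subtype.ext (S.injective (congrArg Subtype.val h)), fun b => by
          obtain ⟨c, hc⟩ := hr b b.2
          exact ⟨⟨c, apply_mem_orbit_iff.1 (hc ▸ b.2)⟩, Subtype.ext hc⟩⟩
    have hσ : ∀ (n : ℕ) (b : S.orbit a), (((σ ^ n) b : S.orbit a) : S.Carrier) = S.f^[n] b := by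
      intro n b
      induction n with
      | zero => rfl
      | succ n ih => rw [pow_succ', Equiv.Perm.mul_apply, iterate_succ_apply', ← ih]; rfl
    let a' : S.orbit a := ⟨a, mem_orbit_self a⟩
    have hp := encard_orbit_eq_top_iff.1 hinf
    have hfree : ∀ n : ℕ, (σ ^ n) a' = a' → n = 0 := fun n h =>
      iterate_injective_of_minimalPeriod_eq_zero hp ((hσ n a').symm.trans (congrArg Subtype.val h))
    refine ⟨Equiv.ofBijective (fun z : ℤ => (σ ^ z) a') ⟨?_, ?_⟩, ?_⟩
    · intro y z h
      have h' : (σ ^ (y - z)) a' = a' := by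
        rw [sub_eq_neg_add, zpow_add, Equiv.Perm.mul_apply]
        simp only at h
        rw [h, zpow_neg, Equiv.Perm.inv_eq_iff_eq]
      rcases Int.eq_nat_or_neg (y - z) with ⟨n, hn | hn⟩
      · rw [hn, zpow_natCast] at h'
        have := hfree n h'
        omega
      · rw [hn, zpow_neg, zpow_natCast, Equiv.Perm.inv_eq_iff_eq] at h'
        have := hfree n h'.symm
        omega
    · rintro ⟨b, n, h | h⟩
      · refine ⟨n, ?_⟩
        simp only [zpow_natCast]
        exact Subtype.ext ((hσ n a').trans h)
      · refine ⟨-n, ?_⟩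
        simp only [zpow_neg, zpow_natCast]
        rw [Equiv.Perm.inv_eq_iff_eq]
        exact Subtype.ext ((hσ n _).trans h).symm
    · intro z
      change (((σ ^ (z + 1)) a' : S.orbit a) : S.Carrier) = S.f ((σ ^ z) a' : S.orbit a)
      rw [add_comm, zpow_add, zpow_one, Equiv.Perm.mul_apply]
      rfl

theorem orbit_mem_zOrbits {a : S.Carrier} (ha : ∀ n, a ∈ Set.range S.f^[n])
    (hp : minimalPeriod S.f a = 0) : S.orbit a ∈ S.zOrbits := by
  rw [zOrbits_eq]
  refine ⟨⟨a, rfl⟩, encard_orbit_eq_top_iff.2 hp, ?_⟩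
  rintro b ⟨n | n, h | h⟩
  · exact (show a = b from h) ▸ ha 1
  · exact (show b = a from h) ▸ ha 1
  · exact ⟨_, (iterate_succ_apply' S.f n a).symm.trans h⟩
  · obtain ⟨c, hc⟩ := ha (n + 1 + 1)
    refine ⟨c, S.iterate_injective (n + 1) ?_⟩
    rw [← iterate_succ_apply, hc, h]

/-- The `ω`-orbits correspond to the points without a preimage, their initial points. -/
theorem mk_omegaOrbits (S : InjectionStructure) :
    Cardinal.mk S.omegaOrbits = Cardinal.mk ((Set.range S.f)ᶜ : Set S.Carrier) := by
  refine (Cardinal.mk_congr (Equiv.ofBijective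
    (fun a : ((Set.range S.f)ᶜ : Set S.Carrier) => (⟨S.orbit a, ?_⟩ : S.omegaOrbits)) ⟨?_, ?_⟩)).symm
  · rw [omegaOrbits_eq]
    exact ⟨⟨a, rfl⟩, a, mem_orbit_self _, a.2⟩
  · intro a b h
    have h' : S.orbit a = S.orbit b := congrArg Subtype.val h
    exact Subtype.ext (eq_of_mem_orbit_of_notMem_range b.2 a.2 (orbit_eq_orbit_iff.1 h'))
  · rintro ⟨O, hO⟩
    rw [omegaOrbits_eq] at hO
    obtain ⟨hO, a, ha, har⟩ := hO
    exact ⟨⟨a, har⟩, Subtype.ext (eq_orbit_of_mem hO ha).symm⟩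

end Orbits

/-! ### Classification of injection structures by their orbits -/

section Classification

variable {S T : InjectionStructure}

theorem IsIsomorphic.image_orbit {e : S.Carrier ≃ T.Carrier} (he : ∀ a, e (S.f a) = T.f (e a))
    (a : S.Carrier) : e '' S.orbit a = T.orbit (e a) := by
  have hit : ∀ (n : ℕ) b, e (S.f^[n] b) = T.f^[n] (e b) := fun n =>
    (Semiconj.iterate_right (f := e) he n)
  ext c
  obtain ⟨b, rfl⟩ := e.surjective c
  rw [e.injective.mem_set_image, mem_orbit_iff, mem_orbit_iff]
  simp only [← hit, e.injective.eq_iff]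

theorem IsIsomorphic.zOrbits_infinite (h : S.IsIsomorphic T) (hS : S.zOrbits.Infinite) :
    T.zOrbits.Infinite := by
  obtain ⟨e, he⟩ := h
  refine (hS.image (f := fun O => e '' O) e.injective.image_injective.injOn).mono ?_
  rintro _ ⟨O, hO, rfl⟩
  rw [zOrbits_eq] at hO ⊢
  obtain ⟨⟨a, rfl⟩, hinf, hr⟩ := hO
  refine ⟨⟨e a, (image_orbit he a).symm⟩, ?_, ?_⟩
  · simp only
    rw [e.injective.encard_image, hinf]
  · rintro _ ⟨b, hb, rfl⟩
    obtain ⟨c, rfl⟩ := hr b hb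
    exact ⟨e c, (he c).symm⟩

/-- The correspondence between two injection structures determined by matching base points
`x i` and `y i` of their orbits: `a` and `b` are related if they occupy the same position relative
to a pair of matching base points. -/
def BaseRel {ι : Type} (x : ι → S.Carrier) (y : ι → T.Carrier) (a : S.Carrier) (b : T.Carrier) :
    Prop :=
  ∃ i m n, S.f^[m] a = S.f^[n] (x i) ∧ T.f^[m] b = T.f^[n] (y i)

theorem BaseRel.symm {ι : Type} {x : ι → S.Carrier} {y : ι → T.Carrier} {a : S.Carrier}
    {b : T.Carrier} (h : BaseRel x y a b) : BaseRel y x b a := by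
  obtain ⟨i, m, n, h, h'⟩ := h
  exact ⟨i, m, n, h', h⟩

theorem BaseRel.apply {ι : Type} {x : ι → S.Carrier} {y : ι → T.Carrier} {a : S.Carrier}
    {b : T.Carrier} (h : BaseRel x y a b) : BaseRel x y (S.f a) (T.f b) := by
  obtain ⟨i, m, n, h, h'⟩ := h
  refine ⟨i, m, n + 1, ?_, ?_⟩
  · rw [← iterate_succ_apply, iterate_succ_apply', h, iterate_succ_apply']
  · rw [← iterate_succ_apply, iterate_succ_apply', h', iterate_succ_apply']

/-- `BaseRel x y` is single-valued, as `x` meets no orbit twice and the period of a point decides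
which of its iterates coincide. -/
theorem BaseRel.unique {ι : Type} {x : ι → S.Carrier} {y : ι → T.Carrier}
    (hx : ∀ i j, x i ∈ S.orbit (x j) → i = j)
    (hper : ∀ i, minimalPeriod S.f (x i) = minimalPeriod T.f (y i))
    {a : S.Carrier} {b c : T.Carrier} (hb : BaseRel x y a b) (hc : BaseRel x y a c) : b = c := by
  obtain ⟨i, m, n, h1, h2⟩ := hb
  obtain ⟨j, p, q, h3, h4⟩ := hc
  have hij : i = j := by
    apply hx
    rw [mem_orbit_iff]
    refine ⟨m + q, p + n, ?_⟩
    rw [iterate_add_apply, ← h3, iterate_add_apply, ← h1, ← iterate_add_apply,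
      ← iterate_add_apply, add_comm]
  subst hij
  apply T.iterate_injective (p + m)
  have hS : S.f^[p + n] (x i) = S.f^[m + q] (x i) := by
    rw [iterate_add_apply, ← h1, iterate_add_apply, ← h3, ← iterate_add_apply,
      ← iterate_add_apply, add_comm]
  rw [iterate_eq_iterate_iff, hper, ← iterate_eq_iterate_iff] at hS
  rw [iterate_add_apply, h2, ← iterate_add_apply, hS, add_comm p m, iterate_add_apply,
    iterate_add_apply, h4]

theorem BaseRel.exists {ι : Type} {x : ι → S.Carrier} {y : ι → T.Carrier}
    (hx : ∀ a, ∃ i, a ∈ S.orbit (x i))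
    (hran : ∀ i n, x i ∈ Set.range S.f^[n] → y i ∈ Set.range T.f^[n]) (a : S.Carrier) :
    ∃ b, BaseRel x y a b := by
  obtain ⟨i, n, h | h⟩ := hx a
  · exact ⟨T.f^[n] (y i), i, 0, n, h.symm, rfl⟩
  · obtain ⟨b, hb⟩ := hran i n ⟨a, h⟩
    exact ⟨b, i, n, 0, h, hb⟩

/-- Let `x` and `y` select one base point from every orbit of `S` and `T`. If matching base points
have the same period and the same number of iterated preimages, then `BaseRel x y` is the graph of
an isomorphism. -/
theorem isIsomorphic_of_base {ι : Type} {x : ι → S.Carrier} {y : ι → T.Carrier}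
    (hx : ∀ a, ∃ i, a ∈ S.orbit (x i)) (hy : ∀ b, ∃ i, b ∈ T.orbit (y i))
    (hx' : ∀ i j, x i ∈ S.orbit (x j) → i = j) (hy' : ∀ i j, y i ∈ T.orbit (y j) → i = j)
    (hper : ∀ i, minimalPeriod S.f (x i) = minimalPeriod T.f (y i))
    (hran : ∀ i n, x i ∈ Set.range S.f^[n] ↔ y i ∈ Set.range T.f^[n]) :
    S.IsIsomorphic T := by
  choose u hu using BaseRel.exists hx fun i n => (hran i n).1
  choose v hv using BaseRel.exists hy fun i n => (hran i n).2
  have huniq := fun a b c => BaseRel.unique (a := a) (b := b) (c := c) hx' hper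
  have huniq' := fun a b c => BaseRel.unique (a := a) (b := b) (c := c) hy' fun i => (hper i).symm
  exact ⟨⟨u, v, fun a => huniq' _ _ _ (hv (u a)) (hu a).symm,
    fun b => huniq _ _ _ (hu (v b)) (hv b).symm⟩, fun a => huniq _ _ _ (hu (S.f a)) (hu a).apply⟩

/-- The isomorphism type of an orbit is recorded by its size together with the information whether
it has an initial point. -/
noncomputable def kind (S : InjectionStructure) (O : Set S.Carrier) : ℕ∞ × Prop :=
  (O.encard, ∃ a ∈ O, a ∉ Set.range S.f)

/-- An orbit has a base point that is its initial point whenever there is one. -/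
theorem exists_base {O : Set S.Carrier} (hO : O ∈ S.orbits) :
    ∃ a ∈ O, ∀ n, a ∈ Set.range S.f^[n] ↔ n = 0 ∨ ¬ (S.kind O).2 := by
  by_cases h : (S.kind O).2
  · obtain ⟨a, ha, har⟩ := id h
    refine ⟨a, ha, fun n => ⟨?_, ?_⟩⟩
    · rintro ⟨b, hb⟩
      rcases n with _ | n
      · exact Or.inl rfl
      · exact absurd ⟨_, (iterate_succ_apply' S.f n b).symm.trans hb⟩ har
    · rintro (rfl | h')
      · exact ⟨a, rfl⟩
      · exact absurd h h'
  · obtain ⟨a, ha⟩ := nonempty_of_mem_orbits hO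
    refine ⟨a, ha, fun n => ⟨fun _ => Or.inr h, fun _ => ?_⟩⟩
    have hr : ∀ b ∈ O, b ∈ Set.range S.f := fun b hb => by
      by_contra hbr
      exact h ⟨b, hb, hbr⟩
    have hpre : ∀ n, ∃ b ∈ O, S.f^[n] b = a := by
      intro n
      induction n with
      | zero => exact ⟨a, ha, rfl⟩
      | succ n ih =>
        obtain ⟨b, hb, rfl⟩ := ih
        obtain ⟨c, rfl⟩ := hr b hb
        refine ⟨c, ?_, iterate_succ_apply S.f n c⟩
        rw [eq_orbit_of_mem hO hb, ← apply_mem_orbit_iff]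
        exact mem_orbit_self _
    obtain ⟨b, -, hb⟩ := hpre n
    exact ⟨b, hb⟩

theorem isIsomorphic_of_mk_kind_eq
    (h : ∀ t, Cardinal.mk {O // O ∈ S.orbits ∧ S.kind O = t} =
      Cardinal.mk {O // O ∈ T.orbits ∧ T.kind O = t}) : S.IsIsomorphic T := by
  have h' : ∀ t, Nonempty ({O : S.orbits // S.kind O = t} ≃ {O : T.orbits // T.kind O = t}) := by
    intro t
    obtain ⟨e⟩ := Cardinal.eq.1 (h t)
    exact ⟨((Equiv.subtypeSubtypeEquivSubtypeInter (· ∈ S.orbits) (fun O => S.kind O = t)).trans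
      e).trans (Equiv.subtypeSubtypeEquivSubtypeInter (· ∈ T.orbits)
        (fun O => T.kind O = t)).symm⟩
  have E := fun t => Classical.choice (h' t)
  let σ : S.orbits ≃ T.orbits :=
    ((Equiv.sigmaFiberEquiv fun O : S.orbits => S.kind O).symm.trans
      (Equiv.sigmaCongrRight E)).trans (Equiv.sigmaFiberEquiv fun O : T.orbits => T.kind O)
  have hσ : ∀ O, T.kind (σ O) = S.kind O := fun O => (E (S.kind O) ⟨O, rfl⟩).2
  choose x hx hxr using fun O : S.orbits => exists_base O.2
  choose y hy hyr using fun O : T.orbits => exists_base O.2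
  refine isIsomorphic_of_base (x := x) (y := fun O => y (σ O)) ?_ ?_ ?_ ?_ ?_ ?_
  · intro a
    refine ⟨⟨S.orbit a, a, rfl⟩, ?_⟩
    rw [orbit_eq_of_mem (hx ⟨S.orbit a, a, rfl⟩)]
    exact mem_orbit_self a
  · intro b
    refine ⟨σ.symm ⟨T.orbit b, b, rfl⟩, ?_⟩
    rw [Equiv.apply_symm_apply, orbit_eq_of_mem (hy ⟨T.orbit b, b, rfl⟩)]
    exact mem_orbit_self b
  · intro O P hOP
    refine Subtype.ext ?_
    rw [eq_orbit_of_mem O.2 (hx O), eq_orbit_of_mem P.2 (hx P)]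
    exact orbit_eq_of_mem hOP
  · intro O P hOP
    refine σ.injective (Subtype.ext ?_)
    rw [eq_orbit_of_mem (σ O).2 (hy (σ O)), eq_orbit_of_mem (σ P).2 (hy (σ P))]
    exact orbit_eq_of_mem hOP
  · intro O
    apply minimalPeriod_eq_of_encard_orbit_eq
    rw [← eq_orbit_of_mem O.2 (hx O), ← eq_orbit_of_mem (σ O).2 (hy (σ O))]
    exact (congrArg Prod.fst (hσ O)).symm
  · intro O n
    rw [hxr, hyr, hσ]

/-- Injection structures with the same numbers of orbits of each isomorphism type are isomorphic. -/
theorem isIsomorphic_of_mk_eq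
    (hfin : ∀ k : ℕ, 0 < k → Cardinal.mk {O // O ∈ S.orbits ∧ O.encard = (k : ℕ∞)} =
      Cardinal.mk {O // O ∈ T.orbits ∧ O.encard = (k : ℕ∞)})
    (homega : Cardinal.mk S.omegaOrbits = Cardinal.mk T.omegaOrbits)
    (hz : Cardinal.mk S.zOrbits = Cardinal.mk T.zOrbits) : S.IsIsomorphic T := by
  -- a finite orbit has no initial point
  have hran : ∀ (U : InjectionStructure) (O : Set U.Carrier), O ∈ U.orbits → O.encard ≠ ⊤ →
      ¬ ∃ a ∈ O, a ∉ Set.range U.f := by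
    rintro U O hO hne ⟨a, ha, har⟩
    rw [eq_orbit_of_mem hO ha, Ne, encard_orbit_eq_top_iff] at hne
    exact har (mem_range_of_minimalPeriod_pos (Nat.pos_of_ne_zero hne))
  have key : ∀ (U : InjectionStructure) (O : Set U.Carrier), O ∈ U.orbits → ∀ t : ℕ∞ × Prop,
      U.kind O = t ↔ O.encard = t.1 ∧ ((∃ a ∈ O, a ∉ Set.range U.f) ↔ t.2) := by
    rintro U O hO ⟨t, p⟩
    rw [kind, Prod.mk.injEq, eq_iff_iff]
  apply isIsomorphic_of_mk_kind_eq
  rintro ⟨t, p⟩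
  induction t using ENat.recTopCoe with
  | top =>
    by_cases hp : p
    · have aux : ∀ U : InjectionStructure,
          Cardinal.mk {O // O ∈ U.orbits ∧ U.kind O = (⊤, p)} = Cardinal.mk U.omegaOrbits := by
        intro U
        refine Cardinal.mk_congr (Equiv.subtypeEquivRight fun O => ?_)
        rw [omegaOrbits_eq]
        refine and_congr_right fun hO => ?_
        rw [key U O hO]
        refine ⟨fun h => h.2.2 hp, fun h => ⟨?_, iff_of_true h hp⟩⟩
        by_contra hne
        exact hran U O hO hne h
      rw [aux, aux, homega]
    · have aux : ∀ U : InjectionStructure,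
          Cardinal.mk {O // O ∈ U.orbits ∧ U.kind O = (⊤, p)} = Cardinal.mk U.zOrbits := by
        intro U
        refine Cardinal.mk_congr (Equiv.subtypeEquivRight fun O => ?_)
        rw [zOrbits_eq]
        refine and_congr_right fun hO => ?_
        rw [key U O hO]
        refine and_congr_right fun _ => ?_
        simp only [iff_false_right hp]
        push Not
        rfl
      rw [aux, aux, hz]
  | coe k =>
    have hempty : ∀ U : InjectionStructure, (k = 0 ∨ p) →
        Cardinal.mk {O // O ∈ U.orbits ∧ U.kind O = ((k : ℕ∞), p)} = 0 := by
      intro U h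
      rw [Cardinal.mk_eq_zero_iff]
      refine ⟨fun ⟨O, hO, hk⟩ => ?_⟩
      rw [key U O hO] at hk
      rcases h with rfl | h
      · exact (nonempty_of_mem_orbits hO).ne_empty (Set.encard_eq_zero.1 hk.1)
      · exact hran U O hO (by rw [hk.1]; exact ENat.natCast_ne_top k) (hk.2.2 h)
    by_cases h : k = 0 ∨ p
    · rw [hempty S h, hempty T h]
    · have aux : ∀ U : InjectionStructure,
          Cardinal.mk {O // O ∈ U.orbits ∧ U.kind O = ((k : ℕ∞), p)} =
            Cardinal.mk {O // O ∈ U.orbits ∧ O.encard = (k : ℕ∞)} := by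
        intro U
        refine Cardinal.mk_congr (Equiv.subtypeEquivRight fun O => ?_)
        refine and_congr_right fun hO => ?_
        rw [key U O hO]
        refine ⟨fun h => h.1, fun h' => ⟨h', iff_of_false (hran U O hO ?_) fun hp => h (Or.inr hp)⟩⟩
        rw [h']
        exact ENat.natCast_ne_top k
      rw [aux, aux, hfin k (Nat.pos_of_ne_zero fun h0 => h (Or.inl h0))]

end Classification

end InjectionStructure

namespace InjectionStructure

open Function

/-! ### Injection structures with an iterate equal to the identity -/

/-- The orbits have uniformly bounded finite sizes exactly when some positive iterate of the
function is the identity. -/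
theorem exists_iterate_eq_self_iff (S : InjectionStructure) :
    (∃ N, 0 < N ∧ ∀ a, S.f^[N] a = a) ↔ S.HasBoundedCharacter ∧ ¬ S.HasInfiniteOrbit := by
  constructor
  · rintro ⟨N, hN, h⟩
    have hdvd : ∀ a, minimalPeriod S.f a ∣ N := fun a => IsPeriodicPt.minimalPeriod_dvd (h a)
    refine ⟨⟨N, ?_⟩, ?_⟩
    · rintro ⟨k, n⟩ ⟨hk, hn, hle⟩
      have hne : {O ∈ S.orbits | O.encard = (k : ℕ∞)}.Nonempty := by
        rw [Set.nonempty_iff_ne_empty]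
        intro h0
        rw [h0, Set.encard_empty] at hle
        exact hn.not_ge (by exact_mod_cast hle)
      obtain ⟨_, ⟨a, rfl⟩, ha⟩ := hne
      rw [encard_orbit_eq_natCast_iff hk] at ha
      exact ha ▸ Nat.le_of_dvd hN (hdvd a)
    · rintro ⟨_, ⟨a, rfl⟩, ha⟩
      rw [← Set.encard_eq_top_iff, encard_orbit_eq_top_iff] at ha
      have := hdvd a
      rw [ha, zero_dvd_iff] at this
      exact hN.ne' this
  · rintro ⟨⟨K, hK⟩, hinf⟩
    refine ⟨K.factorial, K.factorial_pos, fun a => ?_⟩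
    have hpos : 0 < minimalPeriod S.f a := by
      refine Nat.pos_of_ne_zero fun h => hinf ⟨_, ⟨a, rfl⟩, ?_⟩
      rwa [← Set.encard_eq_top_iff, encard_orbit_eq_top_iff]
    refine isPeriodicPt_iff_minimalPeriod_dvd.2 (Nat.dvd_factorial hpos ?_)
    refine hK (minimalPeriod S.f a, 1) ⟨hpos, one_pos, ?_⟩
    rw [Nat.cast_one, Set.one_le_encard_iff_nonempty]
    exact ⟨_, ⟨a, rfl⟩, (encard_orbit_eq_natCast_iff hpos).2 rfl⟩

theorem zOrbits_eq_empty_of_iterate_eq_self {S : InjectionStructure} {N : ℕ} (hN : 0 < N)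
    (h : ∀ a, S.f^[N] a = a) : S.zOrbits = ∅ := by
  rw [zOrbits_eq, Set.eq_empty_iff_forall_notMem]
  rintro _ ⟨⟨a, rfl⟩, ha, -⟩
  rw [encard_orbit_eq_top_iff] at ha
  exact (IsPeriodicPt.minimalPeriod_pos hN (h a)).ne' ha

theorem countable_orbits (S : InjectionStructure) [Countable S.Carrier] : S.orbits.Countable :=
  Set.countable_range _

end InjectionStructure

/-! ### Computable search and iteration -/

section Computability

theorem exists_partrec_search {r : ℕ → ℕ → Bool} (hr : Computable₂ r) :
    ∃ s : ℕ →. ℕ, Partrec s ∧ (∀ i, ∀ n ∈ s i, r i n = true) ∧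
      ∀ i n, r i n = true → ∃ m, m ∈ s i := by
  refine ⟨fun i => Nat.rfind fun n => Part.some (r i n), Partrec.rfind hr.partrec₂, ?_, ?_⟩
  · intro i n hn
    exact (Part.mem_some_iff.1 (Nat.rfind_spec hn)).symm
  · intro i n hn
    obtain ⟨m, hm, -⟩ := Nat.rfind_min' (p := r i) hn
    exact ⟨m, hm⟩

theorem exists_computable_search {r : ℕ → ℕ → Bool} (hr : Computable₂ r)
    (h : ∀ i, ∃ n, r i n = true) : ∃ b : ℕ → ℕ, Computable b ∧ ∀ i, r i (b i) = true := by
  obtain ⟨s, hs, hs', hs''⟩ := exists_partrec_search hr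
  choose b hb using fun i => (h i).elim (hs'' i)
  exact ⟨b, hs.of_eq_tot hb, fun i => hs' i _ (hb i)⟩

theorem Computable.nat_iterate_of {α : Type} [Primcodable α] {g : ℕ → ℕ} {u v : α → ℕ}
    (hg : Computable g) (hu : Computable u) (hv : Computable v) :
    Computable fun i => g^[u i] (v i) := by
  refine (Computable.nat_rec (h := fun _ p => g p.2) hu hv
    (hg.comp (Computable.snd.comp Computable.snd)).to₂).of_eq fun i => ?_
  induction u i with
  | zero => rfl
  | succ n ih => rw [Function.iterate_succ_apply', ← ih]

theorem Primrec.factorial : Primrec Nat.factorial := by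
  refine (Primrec.nat_rec₁ (f := fun n ih => (n + 1) * ih) 1 ?_).of_eq fun n => ?_
  · exact (Primrec.nat_mul.comp (Primrec.succ.comp Primrec.fst) Primrec.snd).to₂
  · induction n with
    | zero => rfl
    | succ n ih => rw [Nat.factorial_succ, ← ih]

theorem rePred_eq {u v : ℕ → ℕ} (hu : Computable u) (hv : Computable v) :
    REPred fun n => u n = v n := by
  refine ComputablePred.to_re (ComputablePred.computable_iff.2 ⟨fun n => u n == v n,
    Primrec.beq.to_comp.comp hu hv, ?_⟩)
  funext n
  simp

end Computability

/-! ### The filter of sets that contain almost all of a cohesive set -/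

section Cohesive

open Filter

/-- The filter generated by the cofinite subsets of `C`. If `C` is cohesive, it decides every c.e.
set, as an ultrafilter would. -/
def tailFilter (C : Set ℕ) : Filter ℕ := cofinite ⊓ 𝓟 C

variable {C : Set ℕ}

theorem almostSubset_iff {S : Set ℕ} :
    AlmostSubset C S ↔ ∀ᶠ i in tailFilter C, i ∈ S := by
  rw [tailFilter, eventually_inf_principal, eventually_cofinite, AlmostSubset]
  have : {x | ¬ (x ∈ C → x ∈ S)} = C \ S := by
    ext x
    simp
  rw [this]

theorem IsCohesive.neBot (hC : IsCohesive C) : (tailFilter C).NeBot :=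
  hC.1.cofinite_inf_principal_neBot

theorem IsCohesive.eventually_or (hC : IsCohesive C) {p : ℕ → Prop} (hp : REPred p) :
    (∀ᶠ i in tailFilter C, p i) ∨ ∀ᶠ i in tailFilter C, ¬ p i := by
  rcases hC.2 {i | p i} hp with h | h
  · refine Or.inr ((almostSubset_iff (S := {i | ¬ p i})).1 (h.subset ?_))
    rintro i ⟨hi, hi'⟩
    exact ⟨not_not.1 hi', hi⟩
  · refine Or.inl ((almostSubset_iff (S := {i | p i})).1 (h.subset ?_))
    rintro i ⟨hi, hi'⟩
    exact ⟨hi', hi⟩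

theorem eventually_tailFilter_ge (n : ℕ) : ∀ᶠ i in tailFilter C, n ≤ i :=
  Eventually.filter_mono inf_le_left (Nat.cofinite_eq_atTop ▸ eventually_ge_atTop n)

end Cohesive

namespace ComputableInjectionStructure

open Filter Function

/-! ### Elements of the cohesive power -/

section Power

variable (A : ComputableInjectionStructure) {C : Set ℕ}

theorem iterate_coe {g : ℕ → ℕ} (hg : ∀ a : A.domain, g a = A.f a) (n : ℕ) (a : A.domain) :
    g^[n] a = (A.f^[n] a : A.domain) := by
  induction n with
  | zero => rfl
  | succ n ih => rw [iterate_succ_apply', ih, hg, iterate_succ_apply']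

/-- The element of the cohesive power represented by `ψ`. -/
def toPower (ψ : A.PowerRep C) : (A.cohesivePower C).Carrier := Quotient.mk _ ψ

theorem exists_toPower (x : (A.cohesivePower C).Carrier) : ∃ ψ, A.toPower ψ = x :=
  Quotient.exists_rep x

variable {A}

theorem toPower_eq_iff {ψ φ : A.PowerRep C} :
    A.toPower ψ = A.toPower φ ↔ ∀ᶠ i in tailFilter C, ∃ a, a ∈ ψ.1 i ∧ a ∈ φ.1 i := by
  exact (Quotient.eq (r := A.powerSetoid C)).trans
    (almostSubset_iff (S := {i | ∃ a, a ∈ ψ.1 i ∧ a ∈ φ.1 i}))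

theorem f_toPower (ψ : A.PowerRep C) :
    (A.cohesivePower C).f (A.toPower ψ) = A.toPower (A.repMap C ψ) := rfl

theorem iterate_f_toPower (n : ℕ) (ψ : A.PowerRep C) :
    (A.cohesivePower C).f^[n] (A.toPower ψ) = A.toPower ((A.repMap C)^[n] ψ) := by
  induction n with
  | zero => rfl
  | succ n ih => rw [iterate_succ_apply', iterate_succ_apply', ih, f_toPower]

theorem mem_iterate_repMap {n : ℕ} {ψ : A.PowerRep C} {i : ℕ} {b : A.domain} :
    b ∈ ((A.repMap C)^[n] ψ).1 i ↔ ∃ a ∈ ψ.1 i, A.f^[n] a = b := by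
  induction n generalizing b with
  | zero => simp
  | succ n ih =>
    rw [iterate_succ_apply']
    change b ∈ (((A.repMap C)^[n] ψ).1 i).map A.f ↔ _
    simp only [Part.mem_map_iff, ih, iterate_succ_apply', exists_exists_and_eq_and]

theorem eventually_exists_mem (ψ : A.PowerRep C) : ∀ᶠ i in tailFilter C, ∃ a, a ∈ ψ.1 i :=
  (almostSubset_iff.1 ψ.2.2).mono fun _ hi => Part.dom_iff_mem.1 hi

theorem iterate_toPower_eq_self_iff {n : ℕ} {ψ : A.PowerRep C} :
    (A.cohesivePower C).f^[n] (A.toPower ψ) = A.toPower ψ ↔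
      ∀ᶠ i in tailFilter C, ∃ a ∈ ψ.1 i, A.f^[n] a = a := by
  rw [iterate_f_toPower, toPower_eq_iff]
  refine eventually_congr (Eventually.of_forall fun i => ?_)
  simp only [mem_iterate_repMap]
  constructor
  · rintro ⟨_, ⟨a, ha, rfl⟩, ha'⟩
    exact ⟨a, ha, Part.mem_unique ha' ha⟩
  · rintro ⟨a, ha, h⟩
    exact ⟨a, ⟨a, ha, h⟩, ha⟩

/-- A c.e. property holds at almost all values of a representative, or fails at almost all. -/
theorem eventually_or (hC : IsCohesive C) (ψ : A.PowerRep C) {p : ℕ → Prop} (hp : REPred p) :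
    (∀ᶠ i in tailFilter C, ∃ a ∈ ψ.1 i, p (a : ℕ)) ∨
      ∀ᶠ i in tailFilter C, ∃ a ∈ ψ.1 i, ¬ p (a : ℕ) := by
  have hre : REPred fun i => ∃ a ∈ ψ.1 i, p (a : ℕ) := by
    refine (Partrec.dom_re (ψ.2.1.bind (hp.comp Computable.snd).to₂)).of_eq fun i => ?_
    rw [Part.dom_iff_mem]
    simp only [Part.mem_bind_iff, Part.mem_map_iff, Part.mem_assert_iff]
    constructor
    · rintro ⟨_, _, ⟨a, ha, rfl⟩, h, -⟩
      exact ⟨a, ha, h⟩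
    · rintro ⟨a, ha, h⟩
      exact ⟨(), _, ⟨a, ha, rfl⟩, h, Part.mem_some _⟩
  refine (hC.eventually_or hre).imp_right fun h => ?_
  filter_upwards [h, eventually_exists_mem ψ] with i hi ⟨a, ha⟩
  exact ⟨a, ha, fun h' => hi ⟨a, ha, h'⟩⟩

variable (A C) in
/-- The representative given by a total computable function into the domain. -/
def repOfComputable (u : ℕ → A.domain) (hu : Computable fun i => (u i : ℕ)) : A.PowerRep C :=
  ⟨fun i => Part.some (u i), hu.partrec.of_eq fun i =>
    (Part.map_some (fun a : A.domain => (a : ℕ)) (u i)).symm,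
    almostSubset_iff.2 (Eventually.of_forall fun _ => trivial)⟩

theorem toPower_repOfComputable_eq_iff {u v : ℕ → A.domain} {hu : Computable fun i => (u i : ℕ)}
    {hv : Computable fun i => (v i : ℕ)} :
    A.toPower (A.repOfComputable C u hu) = A.toPower (A.repOfComputable C v hv) ↔
      ∀ᶠ i in tailFilter C, u i = v i := by
  rw [toPower_eq_iff]
  refine eventually_congr (Eventually.of_forall fun i => ?_)
  simp [repOfComputable]

theorem iterate_repOfComputable_eq_iff {n : ℕ} {u v : ℕ → A.domain}
    {hu : Computable fun i => (u i : ℕ)} {hv : Computable fun i => (v i : ℕ)} :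
    (A.cohesivePower C).f^[n] (A.toPower (A.repOfComputable C u hu)) =
      A.toPower (A.repOfComputable C v hv) ↔ ∀ᶠ i in tailFilter C, A.f^[n] (u i) = v i := by
  rw [iterate_f_toPower, toPower_eq_iff]
  refine eventually_congr (Eventually.of_forall fun i => ?_)
  simp only [mem_iterate_repMap]
  simp [repOfComputable]

variable (A C) in
/-- The canonical embedding of `A` into its cohesive power by constant functions. -/
def diag (a : A.domain) : (A.cohesivePower C).Carrier :=
  A.toPower (A.repOfComputable C (fun _ => a) (Computable.const _))

theorem diag_injective (hC : IsCohesive C) : Injective (A.diag C) := by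
  intro a b h
  have := hC.neBot
  exact (toPower_repOfComputable_eq_iff.1 h).exists.elim fun _ => id

theorem iterate_diag (n : ℕ) (a : A.domain) :
    (A.cohesivePower C).f^[n] (A.diag C a) = A.diag C (A.f^[n] a) :=
  iterate_repOfComputable_eq_iff.2 (Eventually.of_forall fun _ => rfl)

/-- A representative with almost all values in a finite set represents a constant. -/
theorem exists_eq_diag (hC : IsCohesive C) {F : Set A.domain} (hF : F.Finite) {ψ : A.PowerRep C}
    (h : ∀ᶠ i in tailFilter C, ∃ a ∈ ψ.1 i, a ∈ F) : ∃ a, A.toPower ψ = A.diag C a := by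
  by_contra! hne
  have := hC.neBot
  have hall : ∀ a ∈ F, ∀ᶠ i in tailFilter C, ∃ b ∈ ψ.1 i, b ≠ a := by
    intro a _
    rcases eventually_or hC ψ (rePred_eq Computable.id (Computable.const (a : ℕ))) with h' | h'
    · refine absurd (toPower_eq_iff.2 (h'.mono ?_)) (hne a)
      rintro i ⟨b, hb, hba⟩
      exact ⟨b, hb, Part.mem_some_iff.2 (Subtype.ext hba)⟩
    · refine h'.mono ?_
      rintro i ⟨b, hb, hba⟩
      exact ⟨b, hb, fun h => hba (congrArg Subtype.val h)⟩
  rw [← eventually_all_finite hF] at hall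
  obtain ⟨i, ⟨a, ha, haF⟩, hi⟩ := (h.and hall).exists
  obtain ⟨b, hb, hba⟩ := hi a haF
  exact hba (Part.mem_unique hb ha)

variable (A) in
/-- The inverse of the function of `A` is partial computable: its values can be searched for. -/
theorem exists_partrec_preimage : ∃ s : ℕ →. ℕ, Partrec s ∧
    ∀ a : A.domain, (∀ m ∈ s a, ∃ b : A.domain, (b : ℕ) = m ∧ A.f b = a) ∧
      (a ∈ Set.range A.f → ∃ b : A.domain, (b : ℕ) ∈ s a) := by
  obtain ⟨g, hg, hgf⟩ := A.f_computable
  obtain ⟨d, hd, hdA⟩ := ComputablePred.computable_iff.1 A.domain_computable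
  have hdA' : ∀ n, n ∈ A.domain ↔ d n = true := fun n => iff_of_eq (congrFun hdA n)
  have hr : Computable₂ fun n m : ℕ => d m && (g m == n) :=
    (Primrec.and.to_comp.comp (hd.comp Computable.snd)
      (Primrec.beq.to_comp.comp (hg.comp Computable.snd) Computable.fst)).to₂
  obtain ⟨s, hs, hsr, hsd⟩ := exists_partrec_search hr
  have key : ∀ a : A.domain, ∀ m ∈ s a, ∃ b : A.domain, (b : ℕ) = m ∧ A.f b = a := by
    intro a m hm
    have := hsr _ _ hm
    rw [Bool.and_eq_true, ← hdA', beq_iff_eq] at this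
    exact ⟨⟨m, this.1⟩, rfl, Subtype.ext ((hgf ⟨m, this.1⟩).symm.trans this.2)⟩
  refine ⟨s, hs, fun a => ⟨key a, ?_⟩⟩
  rintro ⟨b, rfl⟩
  obtain ⟨m, hm⟩ := hsd (A.f b) b (by
    rw [Bool.and_eq_true, ← hdA', beq_iff_eq]
    exact ⟨b.2, hgf b⟩)
  obtain ⟨c, rfl, -⟩ := key _ m hm
  exact ⟨c, hm⟩

/-- If almost all values of `ψ` have preimages, these preimages can be searched for, which gives a
representative of a preimage. -/
theorem toPower_mem_range_iff {ψ : A.PowerRep C} :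
    A.toPower ψ ∈ Set.range (A.cohesivePower C).f ↔
      ∀ᶠ i in tailFilter C, ∃ a ∈ ψ.1 i, a ∈ Set.range A.f := by
  constructor
  · rintro ⟨y, hy⟩
    obtain ⟨φ, rfl⟩ := A.exists_toPower y
    rw [f_toPower, toPower_eq_iff] at hy
    refine hy.mono ?_
    rintro i ⟨a, ha, ha'⟩
    obtain ⟨b, -, hb⟩ := (Part.mem_map_iff _).1 ha
    exact ⟨a, ha', b, hb⟩
  · intro h
    obtain ⟨s, hs, hsA⟩ := exists_partrec_preimage A
    have hbind : Partrec fun i => ((ψ.1 i).map fun a : A.domain => (a : ℕ)).bind s :=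
      ψ.2.1.bind (hs.comp Computable.snd).to₂
    have hmem : ∀ i m, m ∈ ((ψ.1 i).map fun a : A.domain => (a : ℕ)).bind s →
        ∃ b : A.domain, (b : ℕ) = m ∧ A.f b ∈ ψ.1 i := by
      intro i m hm
      obtain ⟨n, hn, hm⟩ := Part.mem_bind_iff.1 hm
      obtain ⟨a, ha, rfl⟩ := (Part.mem_map_iff _).1 hn
      obtain ⟨b, hb, rfl⟩ := (hsA a).1 m hm
      exact ⟨b, hb, ha⟩
    -- the composition of `ψ` with the partial inverse, as a partial function into the domain
    let φ : ℕ →. A.domain := fun i =>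
      ⟨(((ψ.1 i).map fun a : A.domain => (a : ℕ)).bind s).Dom, fun hd =>
        ⟨(((ψ.1 i).map fun a : A.domain => (a : ℕ)).bind s).get hd, by
          obtain ⟨b, hb, -⟩ := hmem i _ (Part.get_mem hd)
          exact hb ▸ b.2⟩⟩
    have hφ : ∀ i, (φ i).map (fun a : A.domain => (a : ℕ)) =
        ((ψ.1 i).map fun a : A.domain => (a : ℕ)).bind s := fun i => rfl
    have hdom : ∀ᶠ i in tailFilter C, i ∈ φ.Dom := by
      refine h.mono ?_
      rintro i ⟨a, ha, har⟩
      obtain ⟨b, hb⟩ := (hsA a).2 har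
      exact Part.dom_iff_mem.2 ⟨b, Part.mem_bind_iff.2 ⟨a, Part.mem_map _ ha, hb⟩⟩
    let φ' : A.PowerRep C := ⟨φ, hbind.of_eq hφ, almostSubset_iff.2 hdom⟩
    refine ⟨A.toPower φ', (toPower_eq_iff (ψ := A.repMap C φ')).2 (hdom.mono fun i hi => ?_)⟩
    obtain ⟨b, hb⟩ : ∃ b, b ∈ φ i := Part.dom_iff_mem.1 hi
    have hb' : (b : ℕ) ∈ (φ i).map fun a : A.domain => (a : ℕ) := Part.mem_map _ hb
    rw [hφ] at hb'
    obtain ⟨c, hc, hc'⟩ := hmem i b hb'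
    exact ⟨A.f b, Part.mem_map _ hb, Subtype.ext hc ▸ hc'⟩

theorem diag_mem_range_iff (hC : IsCohesive C) {a : A.domain} :
    A.diag C a ∈ Set.range (A.cohesivePower C).f ↔ a ∈ Set.range A.f := by
  have := hC.neBot
  rw [diag, toPower_mem_range_iff]
  simp [repOfComputable]

/-- A point without a preimage is represented by a function almost all of whose values have no
preimage, as the range of a computable function is c.e. -/
theorem eventually_notMem_range (hC : IsCohesive C) {ψ : A.PowerRep C}
    (h : A.toPower ψ ∉ Set.range (A.cohesivePower C).f) :
    ∀ᶠ i in tailFilter C, ∃ a ∈ ψ.1 i, a ∉ Set.range A.f := by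
  obtain ⟨s, hs, hsA⟩ := exists_partrec_preimage A
  have hiff : ∀ a : A.domain, (s a).Dom ↔ a ∈ Set.range A.f := by
    intro a
    rw [Part.dom_iff_mem]
    constructor
    · rintro ⟨m, hm⟩
      obtain ⟨b, -, hb⟩ := (hsA a).1 m hm
      exact ⟨b, hb⟩
    · intro ha
      obtain ⟨b, hb⟩ := (hsA a).2 ha
      exact ⟨b, hb⟩
  rcases eventually_or hC ψ hs.dom_re with h' | h'
  · simp only [hiff] at h'
    exact absurd (toPower_mem_range_iff.2 h') h
  · simpa only [hiff] using h'

/-- A point of positive period `k` is represented by a function almost all of whose values have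
period `k`. -/
theorem eventually_minimalPeriod_eq (hC : IsCohesive C) {ψ : A.PowerRep C} {k : ℕ} (hk : 0 < k)
    (h : minimalPeriod (A.cohesivePower C).f (A.toPower ψ) = k) :
    ∀ᶠ i in tailFilter C, ∃ a ∈ ψ.1 i, minimalPeriod A.f a = k := by
  obtain ⟨g, hg, hgf⟩ := A.f_computable
  have hper : ∀ᶠ i in tailFilter C, ∃ a ∈ ψ.1 i, A.f^[k] a = a := by
    rw [← iterate_toPower_eq_self_iff, ← h, iterate_minimalPeriod]
  have hlt : ∀ j ∈ Set.Ioo 0 k, ∀ᶠ i in tailFilter C, ∃ a ∈ ψ.1 i, A.f^[j] a ≠ a := by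
    rintro j ⟨hj, hjk⟩
    have hre : REPred fun n => g^[j] n = n :=
      rePred_eq (Computable.nat_iterate_of hg (Computable.const j) Computable.id) Computable.id
    rcases eventually_or hC ψ hre with h' | h'
    · simp only [iterate_coe A hgf, ← Subtype.ext_iff] at h'
      refine absurd (iterate_toPower_eq_self_iff.2 h') ?_
      exact not_isPeriodicPt_of_pos_of_lt_minimalPeriod hj.ne' (h ▸ hjk)
    · simpa only [iterate_coe A hgf, ← Subtype.ext_iff] using h'
  rw [← eventually_all_finite (Set.finite_Ioo 0 k)] at hlt
  filter_upwards [hper, hlt] with i ⟨a, ha, hak⟩ hi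
  refine ⟨a, ha, le_antisymm (IsPeriodicPt.minimalPeriod_le hk hak) ?_⟩
  by_contra! hlt
  obtain ⟨b, hb, hbne⟩ := hi _ ⟨IsPeriodicPt.minimalPeriod_pos hk hak, hlt⟩
  rw [Part.mem_unique hb ha] at hbne
  exact hbne iterate_minimalPeriod

theorem minimalPeriod_diag (hC : IsCohesive C) (a : A.domain) :
    minimalPeriod (A.cohesivePower C).f (A.diag C a) = minimalPeriod A.f a := by
  rw [minimalPeriod_eq_minimalPeriod_iff]
  intro n
  rw [IsPeriodicPt, IsFixedPt, iterate_diag, (diag_injective hC).eq_iff]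
  rfl

variable (A C) in
/-- There are only countably many partial computable functions. -/
theorem countable_cohesivePower : Countable (A.cohesivePower C).Carrier := by
  have hcount : {p : ℕ →. ℕ | Nat.Partrec p}.Countable := by
    refine (Set.countable_range Nat.Partrec.Code.eval).mono fun p hp => ?_
    obtain ⟨c, hc⟩ := Nat.Partrec.Code.exists_code.1 hp
    exact ⟨c, hc⟩
  have := hcount.to_subtype
  let F : A.PowerRep C → {p : ℕ →. ℕ | Nat.Partrec p} := fun ψ =>
    ⟨fun i => (ψ.1 i).map fun a : A.domain => (a : ℕ), Partrec.nat_iff.1 ψ.2.1⟩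
  have hF : Injective F := by
    intro ψ φ h
    refine Subtype.ext (funext fun i => Part.ext fun a => ?_)
    have hi := congrArg (fun p => (a : ℕ) ∈ p.1 i) h
    simpa [F, Part.mem_map_iff] using hi
  have := hF.countable
  exact Quotient.countable

/-! ### Orbits of the cohesive power -/

open InjectionStructure

/-- If `A` has only finitely many orbits of size `k`, their union is a finite set, so every point
of period `k` in the cohesive power is represented by a constant. -/
theorem encard_orbits_cohesivePower (hC : IsCohesive C) {k : ℕ} (hk : 0 < k) :
    {O ∈ (A.cohesivePower C).orbits | O.encard = (k : ℕ∞)}.encard =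
      {O ∈ A.toInjectionStructure.orbits | O.encard = (k : ℕ∞)}.encard := by
  set K := {O ∈ A.toInjectionStructure.orbits | O.encard = (k : ℕ∞)}
  have himage : ∀ a : A.domain, minimalPeriod A.f a = k →
      A.diag C '' A.toInjectionStructure.orbit a = (A.cohesivePower C).orbit (A.diag C a) := by
    intro a ha
    rw [orbit_eq_range_of_minimalPeriod_pos (S := A.toInjectionStructure) (hk.trans_eq ha.symm),
      orbit_eq_range_of_minimalPeriod_pos (hk.trans_eq ((minimalPeriod_diag hC a).trans ha).symm)]
    refine (Set.range_comp (A.diag C) _).symm.trans (congrArg Set.range (funext fun n => ?_))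
    exact (iterate_diag n a).symm
  have hsub : (fun O => A.diag C '' O) '' K ⊆
      {O ∈ (A.cohesivePower C).orbits | O.encard = (k : ℕ∞)} := by
    rintro _ ⟨_, ⟨⟨a, rfl⟩, ha⟩, rfl⟩
    rw [encard_orbit_eq_natCast_iff hk] at ha
    refine ⟨⟨A.diag C a, (himage a ha).symm⟩, ?_⟩
    simp only
    rw [himage a ha]
    exact (encard_orbit_eq_natCast_iff hk).2 ((minimalPeriod_diag hC a).trans ha)
  have hinj : Injective fun O : Set A.domain => A.diag C '' O :=
    (diag_injective hC).image_injective
  have henc : ((fun O => A.diag C '' O) '' K).encard = K.encard := hinj.encard_image K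
  refine le_antisymm ?_ (henc ▸ Set.encard_le_encard hsub)
  rcases K.finite_or_infinite with hfin | hinf
  · rw [← henc]
    refine Set.encard_le_encard ?_
    rintro _ ⟨⟨x, rfl⟩, hx⟩
    obtain ⟨ψ, rfl⟩ := A.exists_toPower x
    rw [encard_orbit_eq_natCast_iff hk] at hx
    have hF : {a : A.domain | minimalPeriod A.f a = k}.Finite := by
      refine (hfin.sUnion (s := K) fun O hO => ?_).subset fun a ha => ?_
      · exact Set.finite_of_encard_eq_coe hO.2
      · exact ⟨A.toInjectionStructure.orbit a,
          ⟨⟨a, rfl⟩, (encard_orbit_eq_natCast_iff hk).2 ha⟩, mem_orbit_self a⟩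
    obtain ⟨a, ha⟩ := exists_eq_diag hC hF (eventually_minimalPeriod_eq hC hk hx)
    rw [ha, minimalPeriod_diag hC] at hx
    rw [ha]
    exact ⟨A.toInjectionStructure.orbit a, ⟨⟨a, rfl⟩, (encard_orbit_eq_natCast_iff hk).2 hx⟩,
      himage a hx⟩
  · rw [hinf.encard_eq]
    exact le_top

theorem character_cohesivePower (hC : IsCohesive C) :
    (A.cohesivePower C).character = A.toInjectionStructure.character := by
  ext ⟨k, n⟩
  refine and_congr_right fun hk => ?_
  rw [encard_orbits_cohesivePower hC hk]

theorem mk_orbits_cohesivePower (hC : IsCohesive C) {k : ℕ} (hk : 0 < k) :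
    Cardinal.mk {O // O ∈ (A.cohesivePower C).orbits ∧ O.encard = (k : ℕ∞)} =
      Cardinal.mk {O // O ∈ A.toInjectionStructure.orbits ∧ O.encard = (k : ℕ∞)} := by
  have := countable_cohesivePower A C
  have : Countable A.toInjectionStructure.Carrier := inferInstanceAs (Countable A.domain)
  refine Cardinal.toENat_injOn ?_ ?_ (encard_orbits_cohesivePower hC hk)
  · exact Set.mem_Iic.2 (Cardinal.le_aleph0_iff_set_countable.2
      ((countable_orbits _).mono fun O hO => hO.1))
  · exact Set.mem_Iic.2 (Cardinal.le_aleph0_iff_set_countable.2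
      ((countable_orbits _).mono fun O hO => hO.1))

theorem mk_omegaOrbits_cohesivePower (hC : IsCohesive C) :
    Cardinal.mk (A.cohesivePower C).omegaOrbits =
      Cardinal.mk A.toInjectionStructure.omegaOrbits := by
  rw [mk_omegaOrbits, mk_omegaOrbits]
  let F : ((Set.range A.f)ᶜ : Set A.domain) →
      ((Set.range (A.cohesivePower C).f)ᶜ : Set (A.cohesivePower C).Carrier) :=
    fun a => ⟨A.diag C a, fun h => a.2 ((diag_mem_range_iff hC).1 h)⟩
  have hF : Injective F := fun a b h =>
    Subtype.ext (diag_injective hC (congrArg Subtype.val h))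
  change _ = Cardinal.mk ((Set.range A.f)ᶜ : Set A.domain)
  rcases ((Set.range A.f)ᶜ : Set A.domain).finite_or_infinite with hfin | hinf
  · refine (Cardinal.mk_congr (Equiv.ofBijective F ⟨hF, ?_⟩)).symm
    rintro ⟨x, hx⟩
    obtain ⟨ψ, rfl⟩ := A.exists_toPower x
    obtain ⟨a, ha⟩ := exists_eq_diag hC hfin (eventually_notMem_range hC hx)
    exact ⟨⟨a, fun har => hx (ha ▸ (diag_mem_range_iff hC).2 har)⟩, Subtype.ext ha.symm⟩
  · have := countable_cohesivePower A C
    have := hinf.to_subtype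
    have := Infinite.of_injective F hF
    rw [Cardinal.mk_eq_aleph0, Cardinal.mk_eq_aleph0]

variable (A) in
/-- If no positive iterate of the function is the identity, then a computable function `b` can be
found such that the first `i * i` iterates of `b i` are distinct from each other and from `b i`:
search for a point that is not fixed by the iterate of order `(i * i)!`, which is a multiple of all
periods up to `i * i`. -/
theorem exists_computable_period (h : ∀ N, 0 < N → ∃ a, A.f^[N] a ≠ a) :
    ∃ b : ℕ → A.domain, Computable (fun i => (b i : ℕ)) ∧
      ∀ i p q, p ≤ i * i → q ≤ i * i → A.f^[p] (b i) = A.f^[q] (b i) → p = q := by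
  obtain ⟨g, hg, hgf⟩ := A.f_computable
  obtain ⟨d, hd, hdA⟩ := ComputablePred.computable_iff.1 A.domain_computable
  have hdA' : ∀ n, n ∈ A.domain ↔ d n = true := fun n => iff_of_eq (congrFun hdA n)
  have hfac : Computable fun x : ℕ × ℕ => (x.1 * x.1).factorial :=
    (Primrec.factorial.comp (Primrec.nat_mul.comp Primrec.fst Primrec.fst)).to_comp
  have hr : Computable₂ fun i n : ℕ => d n && !(g^[(i * i).factorial] n == n) :=
    (Primrec.and.to_comp.comp (hd.comp Computable.snd)
      (Primrec.not.to_comp.comp (Primrec.beq.to_comp.comp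
        (Computable.nat_iterate_of hg hfac Computable.snd) Computable.snd))).to₂
  obtain ⟨b, hb, hbr⟩ := exists_computable_search hr fun i => by
    obtain ⟨a, ha⟩ := h _ (i * i).factorial_pos
    refine ⟨a, ?_⟩
    simp only [Bool.and_eq_true, ← hdA', Bool.not_eq_true', beq_eq_false_iff_ne]
    rw [iterate_coe A hgf]
    exact ⟨a.2, fun h' => ha (Subtype.ext h')⟩
  simp only [Bool.and_eq_true, ← hdA', Bool.not_eq_true', beq_eq_false_iff_ne] at hbr
  refine ⟨fun i => ⟨b i, (hbr i).1⟩, hb, fun i p q hp hq hpq => ?_⟩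
  have hne : A.f^[(i * i).factorial] ⟨b i, (hbr i).1⟩ ≠ ⟨b i, (hbr i).1⟩ := by
    intro h'
    refine (hbr i).2 ?_
    have := iterate_coe A hgf (i * i).factorial ⟨b i, (hbr i).1⟩
    rw [h'] at this
    exact this
  have hmod : p ≡ q [MOD minimalPeriod A.f ⟨b i, (hbr i).1⟩] :=
    (iterate_eq_iterate_iff (S := A.toInjectionStructure)).1 hpq
  rcases Nat.eq_zero_or_pos (minimalPeriod A.f ⟨b i, (hbr i).1⟩) with h0 | hpos
  · rwa [h0, Nat.modEq_zero_iff] at hmod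
  · -- a period of size at most `i * i` would divide the factorial
    have hlt : i * i < minimalPeriod A.f ⟨b i, (hbr i).1⟩ := by
      by_contra! hle
      exact hne (isPeriodicPt_iff_minimalPeriod_dvd.2 (Nat.dvd_factorial hpos hle))
    exact hmod.eq_of_lt_of_lt (hp.trans_lt hlt) (hq.trans_lt hlt)

/-- Let the functions `b i` be as in `exists_computable_period`. The functions
`i ↦ f^[(m + 1) * i] (b i)`, one for each `m`, represent points with iterated preimages of all
orders, and no iterate of the function takes one of them to itself or to another one. -/
theorem zOrbits_cohesivePower_infinite (hC : IsCohesive C)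
    (h : ∀ N, 0 < N → ∃ a, A.f^[N] a ≠ a) : (A.cohesivePower C).zOrbits.Infinite := by
  have := hC.neBot
  obtain ⟨g, hg, hgf⟩ := A.f_computable
  obtain ⟨b, hb, hbinj⟩ := exists_computable_period A h
  have hcomp : ∀ {u : ℕ → ℕ}, Computable u →
      Computable fun i => (A.f^[u i] (b i) : ℕ) := fun hu =>
    (Computable.nat_iterate_of hg hu hb).of_eq fun i => iterate_coe A hgf _ _
  have hmul : ∀ m : ℕ, Computable fun i => (m + 1) * i := fun m =>
    (Primrec.nat_mul.comp (Primrec.const _) Primrec.id).to_comp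
  -- The exponents `(m + 1) * i` drift apart as `i` grows but stay below `i * i`, up to which the
  -- iterates of `b i` are distinct.
  let x : ℕ → (A.cohesivePower C).Carrier := fun m =>
    A.toPower (A.repOfComputable C (fun i => A.f^[(m + 1) * i] (b i)) (hcomp (hmul m)))
  have hbound : ∀ m n : ℕ, ∀ᶠ i in tailFilter C, (m + 1) * i + n ≤ i * i := by
    intro m n
    refine (eventually_tailFilter_ge (m + 1 + n)).mono fun i hi => ?_
    rcases Nat.eq_zero_or_pos i with rfl | hi0
    · omega
    · calc (m + 1) * i + n ≤ (m + 1) * i + n * i := by gcongr; exact Nat.le_mul_of_pos_right n hi0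
        _ = (m + 1 + n) * i := by ring
        _ ≤ i * i := by gcongr
  have hiter : ∀ m l n : ℕ, (A.cohesivePower C).f^[n] (x m) = x l → n = 0 ∧ m = l := by
    intro m l n hx
    have hev : ∀ᶠ i in tailFilter C, n + (m + 1) * i = (l + 1) * i := by
      filter_upwards [iterate_repOfComputable_eq_iff.1 hx, hbound m n, hbound l 0] with i hi h1 h2
      rw [← iterate_add_apply] at hi
      exact hbinj i _ _ (by omega) (by omega) hi
    obtain ⟨i, hi, hin⟩ := (hev.and (eventually_tailFilter_ge (n + 1))).exists
    have hn : n = 0 := by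
      refine Nat.eq_zero_of_dvd_of_lt ((Nat.dvd_add_left (Dvd.intro_left (m + 1) rfl)).1 ?_) hin
      exact hi ▸ Dvd.intro_left (l + 1) rfl
    subst hn
    rw [zero_add] at hi
    exact ⟨rfl, Nat.succ_injective (Nat.eq_of_mul_eq_mul_right hin hi)⟩
  have hz : ∀ m, (A.cohesivePower C).orbit (x m) ∈ (A.cohesivePower C).zOrbits := by
    intro m
    refine orbit_mem_zOrbits (fun n => ?_) (hiter m m _ iterate_minimalPeriod).1
    have hsub : Computable fun i => (m + 1) * i - n :=
      Primrec.nat_sub.to_comp.comp (hmul m) (Computable.const n)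
    refine ⟨A.toPower (A.repOfComputable C _ (hcomp hsub)), ?_⟩
    refine iterate_repOfComputable_eq_iff.2 ((eventually_tailFilter_ge n).mono fun i hi => ?_)
    rw [← iterate_add_apply, Nat.add_sub_cancel' (hi.trans (Nat.le_mul_of_pos_left i m.succ_pos))]
  refine Set.infinite_of_injective_forall_mem (f := fun m => (A.cohesivePower C).orbit (x m)) ?_ hz
  intro m l hml
  obtain ⟨n, hn | hn⟩ := orbit_eq_orbit_iff.1 hml
  · exact (hiter l m n hn).2.symm
  · exact (hiter m l n hn).2

theorem iterate_eq_self_cohesivePower {N : ℕ} (h : ∀ a, A.f^[N] a = a)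
    (x : (A.cohesivePower C).Carrier) : (A.cohesivePower C).f^[N] x = x := by
  obtain ⟨ψ, rfl⟩ := A.exists_toPower x
  exact iterate_toPower_eq_self_iff.2 ((eventually_exists_mem ψ).mono fun i ⟨a, ha⟩ =>
    ⟨a, ha, h a⟩)

end Power

end ComputableInjectionStructure

theorem mainTheorem2 (A : ComputableInjectionStructure) (C : Set ℕ) (hC : IsCohesive C) :
    (A.cohesivePower C).character = A.toInjectionStructure.character ∧
    Cardinal.mk (A.cohesivePower C).omegaOrbits = Cardinal.mk A.toInjectionStructure.omegaOrbits ∧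
    (¬ A.toInjectionStructure.HasBoundedCharacter ∨ A.toInjectionStructure.HasInfiniteOrbit →
      (A.cohesivePower C).zOrbits.Infinite) ∧
    ((A.cohesivePower C).IsIsomorphic A.toInjectionStructure ↔
      (A.toInjectionStructure.HasBoundedCharacter ∧ ¬ A.toInjectionStructure.HasInfiniteOrbit) ∨
        A.toInjectionStructure.zOrbits.Infinite) := by
  -- unbounded finite orbits or an infinite orbit: no positive iterate is the identity
  have hz : ¬ (A.toInjectionStructure.HasBoundedCharacter ∧
      ¬ A.toInjectionStructure.HasInfiniteOrbit) → (A.cohesivePower C).zOrbits.Infinite := by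
    intro h
    rw [← InjectionStructure.exists_iterate_eq_self_iff] at h
    push Not at h
    exact ComputableInjectionStructure.zOrbits_cohesivePower_infinite hC h
  have homega := ComputableInjectionStructure.mk_omegaOrbits_cohesivePower (A := A) hC
  refine ⟨ComputableInjectionStructure.character_cohesivePower hC, homega, fun h => hz ?_, ?_, ?_⟩
  · rintro ⟨h1, h2⟩
    exact h.elim (fun h => h h1) h2
  · intro h
    by_contra hne
    rw [not_or] at hne
    exact hne.2 (h.zOrbits_infinite (hz hne.1))
  · intro h
    refine InjectionStructure.isIsomorphic_of_mk_eq
      (fun k hk => ComputableInjectionStructure.mk_orbits_cohesivePower hC hk) homega ?_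
    by_cases hb : A.toInjectionStructure.HasBoundedCharacter ∧
        ¬ A.toInjectionStructure.HasInfiniteOrbit
    · obtain ⟨N, hN, hf⟩ := A.toInjectionStructure.exists_iterate_eq_self_iff.2 hb
      rw [InjectionStructure.zOrbits_eq_empty_of_iterate_eq_self hN hf,
        InjectionStructure.zOrbits_eq_empty_of_iterate_eq_self hN
          (ComputableInjectionStructure.iterate_eq_self_cohesivePower hf),
        Cardinal.mk_eq_zero, Cardinal.mk_eq_zero]
    · have := ComputableInjectionStructure.countable_cohesivePower A C
      have : Countable A.toInjectionStructure.Carrier := inferInstanceAs (Countable A.domain)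
      have hcount : ∀ (S : InjectionStructure) [Countable S.Carrier],
          S.zOrbits.Infinite → Cardinal.mk S.zOrbits = Cardinal.aleph0 := by
        intro S _ hS
        have := hS.to_subtype
        have : Countable S.zOrbits := (S.countable_orbits.mono fun O hO => hO.1).to_subtype
        exact Cardinal.mk_eq_aleph0 _
      rw [hcount _ (hz hb), hcount _ (h.resolve_left hb)]
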